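/- Let $\Omega\subset\mathbb R^d$ be a bounded convex open set, let $s\ge 1$, $0<\theta_r\le 1$ $(1\le r\le s)$, $a_1>0$, $a_r\ge 0$ $(2\le r\le s)$, $1<\alpha_l\le 2$, and let $\varepsilon^\pm_{\alpha_l}\ge 0$ be constants $(1\le l\le d)$. For a function $u$ on $\Omega$ and $x\in\Omega$ let $x_l^-$ and $x_l^+$ be the infimum and the supremum of the $l$-th coordinates of the points of $\Omega$ on the line through $x$ in the $l$-th coordinate direction, and, for $\alpha_l<2$, set $$\frac{\partial_+^{\alpha_l}u}{\partial x_{l,+}^{\alpha_l}}(x)=\frac{1}{\Gamma(2-\alpha_l)}\int_{x_l^-}^{x_l}\frac{\partial_l^2u(x_1,\dots,\xi,\dots,x_d)}{(x_l-\xi)^{\alpha_l-1}}\,d\xi,\qquad \frac{\partial_-^{\alpha_l}u}{\partial x_{l,-}^{\alpha_l}}(x)=\frac{1}{\Gamma(2-\alpha_l)}\int_{x_l}^{x_l^+}\frac{\partial_l^2u(x_1,\dots,\xi,\dots,x_d)}{(\xi-x_l)^{\alpha_l-1}}\,d\xi ,$$ with $\xi$ in the $l$-th place; for $\alpha_l=2$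 both are $\partial_l^2u(x)$. Let $\omega_k^\theta=\prod_{j=0}^{k-1}\frac{j-\theta}{j+1}$ be the coefficients of $(1-z)^\theta$, so that $\omega^\theta_k=\frac{\Gamma(k-\theta)}{\Gamma(-\theta)\Gamma(k+1)}$ for $0<\theta<1$. For a step size $\tau>0$, a number of steps $N$, $t_n=n\tau$, a source $f$ and boundary data $g$, consider the semi-discrete scheme for $U^0,\dots,U^N\in L^2(\Omega)$: for $1\le n\le N$, $$\sum_{r=1}^s\frac{a_r\omega_0^{\theta_r}}{\tau^{\theta_r}}U^n-\sum_{l=1}^d\varepsilon^+_{\alpha_l}\frac{\partial_+^{\alpha_l}U^n}{\partial x_{l,+}^{\alpha_l}}-\sum_{l=1}^d\varepsilon^-_{\alpha_l}\frac{\partial_-^{\alpha_l}U^n}{\partial x_{l,-}^{\alpha_l}}=f(\cdot,t_n)-\sum_{r=1}^s\frac{a_r}{\tau^{\theta_r}}\sum_{k=1}^{n-1}\omega_k^{\theta_r}U^{n-k}+\sum_{r=1}^s\frac{a_r}{\tau^{\theta_r}}\sum_{k=0}^{n-1}\omega_k^{\theta_r}U^0\quad\text{in }\Omega,$$ and $U^n=g(\cdot,t_n)$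 on $\partial\Omega$, where for $1\le n\le N$ the function $U^n$ is $C^2$ in $\Omega$, the integrals defining its fractional derivatives converge absolutely at every point of $\Omega$, and the derivatives $\partial_\pm^{\alpha_l}U^n/\partial x_{l,\pm}^{\alpha_l}$ belong to $L^2(\Omega)$. Then the scheme is unconditionally stable: for every $\tau>0$ and every $N$, if $(U^n)$ and $(\tilde U^n)$ are two solutions of the scheme with the same $f$ and $g$, with initial functions $U^0,\tilde U^0\in L^2(\Omega)$, and if the errors $e^n=U^n-\tilde U^n$ $(1\le n\le N)$ have zero gradient on $\partial\Omega$ (in particular, if all $U^n$ and $\tilde U^n$ with $1\le n\le N$ do), then $$\|e^n\|_{L^2(\Omega)}\le\|e^0\|_{L^2(\Omega)}\qquad\text{for all }0\le n\le N .$$ Boundary values of functions and of gradients are understood as limits from inside $\Omega$. -/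

import Mathlib

open Set Filter Topology MeasureTheory

noncomputable section

namespace FracScheme

/-- The Grünwald coefficients `ω^θ_k`, i.e. the Taylor coefficients of `(1 - z)^θ`,
as the finite product `∏_{j<k} (j - θ)/(j + 1)`. This is `Γ(k-θ) / (Γ(-θ) Γ(k+1))`
(see `omega_eq_Gamma`), read as its limit at the pole `θ = 1`. -/
def omega (θ : ℝ) (k : ℕ) : ℝ :=
  ∏ j ∈ Finset.range k, ((j : ℝ) - θ) / ((j : ℝ) + 1)

theorem omega_zero (θ : ℝ) : omega θ 0 = 1 := by
  simp [omega]

theorem omega_succ (θ : ℝ) (k : ℕ) :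
    omega θ (k + 1) = (1 - (θ + 1) / ((k : ℝ) + 1)) * omega θ k := by
  have h : (k : ℝ) + 1 ≠ 0 := by positivity
  rw [omega, Finset.prod_range_succ, mul_comm, omega]
  congr 1
  field_simp
  ring

/-- The closed form of the coefficients away from the poles of the Gamma function. -/
theorem omega_eq_Gamma (θ : ℝ) (h0 : 0 < θ) (h1 : θ < 1) (k : ℕ) :
    omega θ k = Real.Gamma ((k : ℝ) - θ) / (Real.Gamma (-θ) * Real.Gamma ((k : ℝ) + 1)) := by
  have hne : ∀ j : ℕ, (j : ℝ) - θ ≠ 0 := by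
    intro j hj
    rcases j with _ | j
    · simp at hj
      linarith
    · have : (0 : ℝ) ≤ (j : ℝ) := Nat.cast_nonneg j
      push_cast at hj
      linarith
  have hG : Real.Gamma (-θ) ≠ 0 := by
    apply Real.Gamma_ne_zero
    intro m hm
    apply hne m
    linarith
  induction k with
  | zero => simp [omega, hG]
  | succ k ih =>
    have hk : (k : ℝ) + 1 ≠ 0 := by positivity
    have e1 : ((k + 1 : ℕ) : ℝ) - θ = ((k : ℝ) - θ) + 1 := by
      push_cast
      ring
    have e2 : Real.Gamma ((k : ℝ) + 1) ≠ 0 := (Real.Gamma_pos_of_pos (by positivity)).ne'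
    have e3 : ((k + 1 : ℕ) : ℝ) + 1 = ((k : ℝ) + 1) + 1 := by
      push_cast
      ring
    rw [e1, e3, Real.Gamma_add_one (hne k), Real.Gamma_add_one hk, omega,
      Finset.prod_range_succ, ← omega, ih]
    field_simp

/-- Left Caputo derivative of order `1 < α ≤ 2` with base point `a`. -/
def caputoLeft (α a : ℝ) (v : ℝ → ℝ) (x : ℝ) : ℝ :=
  if α = 2 then iteratedDeriv 2 v x
  else (Real.Gamma (2 - α))⁻¹ * ∫ ξ in a..x, iteratedDeriv 2 v ξ / (x - ξ) ^ (α - 1)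

/-- Right Caputo derivative of order `1 < α ≤ 2` with base point `b`. -/
def caputoRight (α b : ℝ) (v : ℝ → ℝ) (x : ℝ) : ℝ :=
  if α = 2 then iteratedDeriv 2 v x
  else (Real.Gamma (2 - α))⁻¹ * ∫ ξ in x..b, iteratedDeriv 2 v ξ / (ξ - x) ^ (α - 1)

/-! Points of `ℝ^d` are functions `Fin d → ℝ` with Lebesgue measure; only the topology, the
linear structure and the measure of `ℝ^d` are used, never its norm. -/

variable {d : ℕ}

/-- Restriction of `u` to the line through `x` in the `l`-th coordinate direction,
parametrized by the `l`-th coordinate. -/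
def slice (u : (Fin d → ℝ) → ℝ) (l : Fin d) (x : Fin d → ℝ) : ℝ → ℝ :=
  fun ξ => u (Function.update x l ξ)

/-- The `l`-th coordinate at which the line through `x` in direction `l` enters `Ω`. -/
def lower (Ω : Set (Fin d → ℝ)) (l : Fin d) (x : Fin d → ℝ) : ℝ :=
  sInf {ξ : ℝ | Function.update x l ξ ∈ Ω}

/-- The `l`-th coordinate at which the line through `x` in direction `l` leaves `Ω`. -/
def upper (Ω : Set (Fin d → ℝ)) (l : Fin d) (x : Fin d → ℝ) : ℝ :=
  sSup {ξ : ℝ | Function.update x l ξ ∈ Ω}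

/-- The left space-fractional partial derivative `∂^α_+ u / ∂x^α_{l,+}` on `Ω`. -/
def fracLeft (Ω : Set (Fin d → ℝ)) (α : ℝ) (l : Fin d) (u : (Fin d → ℝ) → ℝ)
    (x : Fin d → ℝ) : ℝ :=
  caputoLeft α (lower Ω l x) (slice u l x) (x l)

/-- The right space-fractional partial derivative `∂^α_- u / ∂x^α_{l,-}` on `Ω`. -/
def fracRight (Ω : Set (Fin d → ℝ)) (α : ℝ) (l : Fin d) (u : (Fin d → ℝ) → ℝ)
    (x : Fin d → ℝ) : ℝ :=
  caputoRight α (upper Ω l x) (slice u l x) (x l)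

/-- The `L²(Ω)` inner product. -/
def inner0 (Ω : Set (Fin d → ℝ)) (u v : (Fin d → ℝ) → ℝ) : ℝ :=
  ∫ x in Ω, u x * v x

/-- The `L²(Ω)` norm. -/
def norm0 (Ω : Set (Fin d → ℝ)) (u : (Fin d → ℝ) → ℝ) : ℝ :=
  Real.sqrt (inner0 Ω u u)

/-- `u` is a function on `Ω` for which all the space-fractional derivatives of orders `α l`
make sense and are square integrable: `u` is twice continuously differentiable in `Ω`, the
integrals defining the derivatives of non-integer order converge absolutely at every point of
`Ω`, and the derivatives belong to `L²(Ω)`. -/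
structure HasFracDerivs (Ω : Set (Fin d → ℝ)) (α : Fin d → ℝ) (u : (Fin d → ℝ) → ℝ) :
    Prop where
  contDiffOn : ContDiffOn ℝ 2 u Ω
  left_conv : ∀ l, α l < 2 → ∀ x ∈ Ω, IntervalIntegrable
    (fun ξ => iteratedDeriv 2 (slice u l x) ξ / (x l - ξ) ^ (α l - 1)) volume
    (lower Ω l x) (x l)
  right_conv : ∀ l, α l < 2 → ∀ x ∈ Ω, IntervalIntegrable
    (fun ξ => iteratedDeriv 2 (slice u l x) ξ / (ξ - x l) ^ (α l - 1)) volume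
    (x l) (upper Ω l x)
  left_memLp : ∀ l, MemLp (fracLeft Ω (α l) l u) 2 (volume.restrict Ω)
  right_memLp : ∀ l, MemLp (fracRight Ω (α l) l u) 2 (volume.restrict Ω)

/-- The `n`-th equation of the semi-discrete scheme with `q = 1` and constant diffusion
coefficients, at the point `x`; `t_n = n τ`. -/
def SchemeEq (Ω : Set (Fin d → ℝ)) {s : ℕ} (a θ : Fin s → ℝ) (α εp εm : Fin d → ℝ)
    (f : (Fin d → ℝ) → ℝ → ℝ) (τ : ℝ) (U : ℕ → (Fin d → ℝ) → ℝ) (n : ℕ) (x : Fin d → ℝ) :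
    Prop :=
  (∑ r, a r * omega (θ r) 0 / τ ^ θ r) * U n x
      - ∑ l, εp l * fracLeft Ω (α l) l (U n) x
      - ∑ l, εm l * fracRight Ω (α l) l (U n) x
    = f x (n * τ)
      - ∑ r, a r / τ ^ θ r * ∑ k ∈ Finset.Ico 1 n, omega (θ r) k * U (n - k) x
      + ∑ r, a r / τ ^ θ r * ∑ k ∈ Finset.range n, omega (θ r) k * U 0 x

/-- `U 0, …, U N` is a solution of the semi-discrete scheme with source `f` and boundary
values `g`. The initial function `U 0` is an arbitrary function in `L²(Ω)`. -/
structure IsSchemeSolution (Ω : Set (Fin d → ℝ)) {s : ℕ} (a θ : Fin s → ℝ)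
    (α εp εm : Fin d → ℝ) (f g : (Fin d → ℝ) → ℝ → ℝ) (τ : ℝ) (N : ℕ)
    (U : ℕ → (Fin d → ℝ) → ℝ) : Prop where
  memLp : ∀ n ≤ N, MemLp (U n) 2 (volume.restrict Ω)
  regular : ∀ n, 1 ≤ n → n ≤ N → HasFracDerivs Ω α (U n)
  equation : ∀ n, 1 ≤ n → n ≤ N → ∀ x ∈ Ω, SchemeEq Ω a θ α εp εm f τ U n x
  boundary : ∀ n, 1 ≤ n → n ≤ N → ∀ p ∈ frontier Ω,
    Tendsto (U n) (𝓝[Ω] p) (𝓝 (g p (n * τ)))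

/-- The gradient of `u` vanishes on the boundary of `Ω` (as a limit from inside `Ω`). -/
def ZeroBoundaryGradient (Ω : Set (Fin d → ℝ)) (u : (Fin d → ℝ) → ℝ) : Prop :=
  ∀ p ∈ frontier Ω, Tendsto (fderiv ℝ u) (𝓝[Ω] p) (𝓝 0)

end FracScheme

end

noncomputable section

namespace FracScheme

/-! This is an energy argument. The errors satisfy `A e^n = D e^n + ∑ W_k e^{n-k} + Z e^0`, where
`D` collects the fractional diffusion terms. Since `ω_k ≤ 0` for `k ≥ 1` and the partial sums of `ω`
are nonnegative, the weights `W_k` and `Z` are nonnegative. They sum to `A`, so the history is `A`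
times a convex combination of earlier errors. Testing with `e^n`, dropping the nonpositive `⟨D e^n,
e^n⟩` and applying Young's inequality bounds `‖e^n‖²` by any common bound of the earlier squared
norms. Only signs matter, so `τ` is unrestricted.

The main point is `⟨D e, e⟩ ≤ 0`. Fubini reduces it to lines, where `s^(1-α)` is a positive
superposition of exponentials `exp (-t s)`, `t > 0` (`integral_rpow_kernel_nonpos`). For one
exponential, set `ψ(x) = ∫_a^x exp (-t (x - ξ)) v'(ξ) dξ`. Applying the kernel to `v''` gives `ψ' =
v' - t ψ`, and integration by parts gives `∫ ψ' v = -ψ(b)²/2 - t ∫ ψ²`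
(`integral_exp_kernel_nonpos`). The boundary terms vanish because the error and its gradient vanish
on the boundary. -/

/-! ### Signs and sums of the Grünwald coefficients. -/

theorem omega_nonpos {θ : ℝ} (h0 : 0 ≤ θ) (h1 : θ ≤ 1) {k : ℕ} (hk : 1 ≤ k) :
    omega θ k ≤ 0 := by
  obtain ⟨m, rfl⟩ := Nat.exists_eq_add_of_le' hk
  -- The factor `j = 0` equals `-θ`; all later factors are nonnegative because `θ ≤ 1`.
  rw [omega, Finset.prod_range_succ']
  refine mul_nonpos_of_nonneg_of_nonpos (Finset.prod_nonneg fun j _ => ?_) ?_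
  · push_cast
    have : (0 : ℝ) ≤ j := Nat.cast_nonneg j
    exact div_nonneg (by linarith) (by linarith)
  · simpa using h0

/-- Partial summation divides the generating function `(1 - z)^θ` by `1 - z`, so the sums are the
coefficients of `(1 - z)^(θ - 1)`. In this product form the sign is visible. -/
theorem sum_omega_eq_prod (θ : ℝ) (n : ℕ) :
    ∑ k ∈ Finset.range (n + 1), omega θ k
      = ∏ j ∈ Finset.range n, ((j : ℝ) + 1 - θ) / ((j : ℝ) + 1) := by
  -- The induction also carries `ω_{n+1}`, the next summand, as a multiple of the same product.
  have key : ∀ n : ℕ, ∑ k ∈ Finset.range (n + 1), omega θ k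
      = ∏ j ∈ Finset.range n, ((j : ℝ) + 1 - θ) / ((j : ℝ) + 1) ∧
      ((n : ℝ) + 1) * omega θ (n + 1)
        = -θ * ∏ j ∈ Finset.range n, ((j : ℝ) + 1 - θ) / ((j : ℝ) + 1) := by
    intro n
    induction n with
    | zero => simp [omega]
    | succ n ih =>
      obtain ⟨ih1, ih2⟩ := ih
      have hn : (n : ℝ) + 1 ≠ 0 := by positivity
      have hn' : (n : ℝ) + 1 + 1 ≠ 0 := by positivity
      have e : omega θ (n + 1)
          = -θ * (∏ j ∈ Finset.range n, ((j : ℝ) + 1 - θ) / ((j : ℝ) + 1)) / ((n : ℝ) + 1) := by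
        rw [← ih2]; field_simp
      constructor
      · rw [Finset.sum_range_succ, ih1, Finset.prod_range_succ, e]
        field_simp
        ring
      · rw [omega_succ, e, Finset.prod_range_succ]
        push_cast
        field_simp
        ring
  exact (key n).1

theorem sum_omega_nonneg {θ : ℝ} (h1 : θ ≤ 1) (n : ℕ) :
    0 ≤ ∑ k ∈ Finset.range n, omega θ k := by
  cases n with
  | zero => simp
  | succ n =>
    rw [sum_omega_eq_prod]
    refine Finset.prod_nonneg fun j _ => ?_
    have : (0 : ℝ) ≤ j := Nat.cast_nonneg j
    exact div_nonneg (by linarith) (by linarith)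

/-- The terms with `k ≥ 1` cancel and leave `ω_0 = 1`. This makes the history weights sum to the
coefficient of `U^n`. -/
theorem sum_Ico_neg_omega_add_sum_range (θ : ℝ) {n : ℕ} (hn : 1 ≤ n) :
    ∑ k ∈ Finset.Ico 1 n, -omega θ k + ∑ k ∈ Finset.range n, omega θ k = 1 := by
  rw [Finset.range_eq_Ico, Finset.sum_eq_sum_Ico_succ_bot (a := 0) (by omega), omega_zero,
    Finset.sum_neg_distrib, zero_add]
  ring

/-! ### Negativity of one-sided kernels on an interval. -/

/-- `exp (-t (x - ξ)) * p ξ` integrated over `ξ < x`, in terms of an antiderivative of `p`. -/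
theorem integral_exp_mul_deriv {a b x t : ℝ} {w p : ℝ → ℝ} (hax : a ≤ x) (hxb : x ≤ b)
    (hw : Continuous w) (hwp : ∀ x ∈ Ioo a b, HasDerivAt w (p x) x)
    (hp : IntervalIntegrable p volume a b) (hwa : w a = 0) :
    ∫ ξ in a..x, Real.exp (-t * (x - ξ)) * p ξ
      = w x - t * (Real.exp (-t * x) * ∫ ξ in a..x, Real.exp (t * ξ) * w ξ) := by
  have hpx : IntervalIntegrable p volume a x :=
    hp.mono_set (by rw [uIcc_of_le hax, uIcc_of_le (hax.trans hxb)]; exact Icc_subset_Icc_right hxb)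
  have hi1 : IntervalIntegrable (fun ξ => Real.exp (t * ξ) * p ξ) volume a x :=
    hpx.continuousOn_mul (by fun_prop)
  have hi2 : IntervalIntegrable (fun ξ => t * (Real.exp (t * ξ) * w ξ)) volume a x :=
    Continuous.intervalIntegrable (by fun_prop) _ _
  -- Integration by parts against `exp (t ξ)`; `w a = 0` removes the lower boundary term.
  have ftc := intervalIntegral.integral_eq_sub_of_hasDerivAt_of_le hax
    (f := fun ξ => Real.exp (t * ξ) * w ξ)
    (f' := fun ξ => Real.exp (t * ξ) * p ξ + t * (Real.exp (t * ξ) * w ξ))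
    (by fun_prop) (fun ξ hξ => by
      have h1 : HasDerivAt (fun ξ => Real.exp (t * ξ)) (Real.exp (t * ξ) * t) ξ := by
        simpa using ((hasDerivAt_id ξ).const_mul t).exp
      exact (h1.mul (hwp ξ ⟨hξ.1, hξ.2.trans_le hxb⟩)).congr_deriv (by ring)) (hi1.add hi2)
  rw [intervalIntegral.integral_add hi1 hi2, intervalIntegral.integral_const_mul, hwa] at ftc
  have e : ∀ ξ, Real.exp (-t * (x - ξ)) * p ξ
      = Real.exp (-t * x) * (Real.exp (t * ξ) * p ξ) := fun ξ => by
    rw [← mul_assoc, ← Real.exp_add]; ring_nf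
  have e2 : Real.exp (-t * x) * Real.exp (t * x) = 1 := by
    rw [← Real.exp_add]; simp
  simp_rw [e]
  rw [intervalIntegral.integral_const_mul]
  linear_combination Real.exp (-t * x) * ftc + w x * e2

/-- The quadratic form of the one-sided exponential kernel applied to a second derivative. -/
theorem integral_exp_kernel_nonpos {a b t : ℝ} {v w p : ℝ → ℝ} (hab : a ≤ b) (ht : 0 ≤ t)
    (hv : Continuous v) (hw : Continuous w) (hvw : ∀ x ∈ Ioo a b, HasDerivAt v (w x) x)
    (hwp : ∀ x ∈ Ioo a b, HasDerivAt w (p x) x)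
    (hp : IntervalIntegrable p volume a b) (hvb : v b = 0) (hwa : w a = 0) :
    ∫ x in a..b, (∫ ξ in a..x, Real.exp (-t * (x - ξ)) * p ξ) * v x ≤ 0 := by
  -- `ψ` solves `ψ' = w - t ψ` with `ψ a = 0`, and by `integral_exp_mul_deriv` this `ψ'` is the
  -- inner integral.
  set ψ : ℝ → ℝ := fun x => Real.exp (-t * x) * ∫ ξ in a..x, Real.exp (t * ξ) * w ξ with hψ
  have hψd : ∀ x, HasDerivAt ψ (w x - t * ψ x) x := fun x => by
    have h1 : HasDerivAt (fun x => Real.exp (-t * x)) (Real.exp (-t * x) * (-t)) x := by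
      simpa using ((hasDerivAt_id x).const_mul (-t)).exp
    have hc : Continuous fun ξ => Real.exp (t * ξ) * w ξ := by fun_prop
    have h2 := hc.integral_hasStrictDerivAt a x
    have e2 : Real.exp (-t * x) * Real.exp (t * x) = 1 := by
      rw [← Real.exp_add]; simp
    refine (h1.mul h2.hasDerivAt).congr_deriv ?_
    simp only [hψ]
    linear_combination w x * e2
  have hψc : Continuous ψ := continuous_iff_continuousAt.2 fun x => (hψd x).continuousAt
  have hψa : ψ a = 0 := by simp [hψ]
  have e1 : ∫ x in a..b, (∫ ξ in a..x, Real.exp (-t * (x - ξ)) * p ξ) * v x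
      = ∫ x in a..b, (w x - t * ψ x) * v x := by
    refine intervalIntegral.integral_congr fun x hx => ?_
    rw [uIcc_of_le hab] at hx
    simp only [hψ]
    rw [integral_exp_mul_deriv hx.1 hx.2 hw hwp hp hwa]
  -- The primitive is chosen so that `w ψ` cancels in its derivative. Since `v b = 0` and `ψ a = 0`,
  -- only `-ψ(b)²/2` survives at the ends.
  have ftc := intervalIntegral.integral_eq_sub_of_hasDerivAt_of_le hab
    (f := fun x => v x * ψ x - ψ x ^ 2 / 2)
    (f' := fun x => (w x - t * ψ x) * v x + t * ψ x ^ 2)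
    (by fun_prop) (fun x hx => by
      refine (((hvw x hx).mul (hψd x)).sub (((hψd x).pow 2).div_const 2)).congr_deriv ?_
      simp only [Nat.cast_ofNat]
      ring) (Continuous.intervalIntegrable (by fun_prop) _ _)
  rw [intervalIntegral.integral_add (Continuous.intervalIntegrable (by fun_prop) _ _)
    (Continuous.intervalIntegrable (by fun_prop) _ _), hvb, hψa] at ftc
  have hpos : 0 ≤ ∫ x in a..b, t * ψ x ^ 2 :=
    intervalIntegral.integral_nonneg hab fun x _ => by positivity
  rw [e1]
  nlinarith [sq_nonneg (ψ b)]

/-- Integrability of the one-sided singular kernel against an `L¹` function. -/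
theorem integrable_rpow_kernel {a b α : ℝ} (hab : a ≤ b) (hα : α < 2) {v p : ℝ → ℝ}
    (hv : Continuous v) (hp : IntegrableOn p (Ioc a b)) :
    Integrable (fun z : ℝ × ℝ => {z : ℝ × ℝ | z.2 < z.1}.indicator
      (fun z => (z.1 - z.2) ^ (1 - α) * (p z.2 * v z.1)) z)
      ((volume.restrict (Ioc a b)).prod (volume.restrict (Ioc a b))) := by
  -- The exponent `1 - α` exceeds `-1`; the cutoff at `b - a` makes the kernel globally `L¹` without
  -- changing it on the square.
  have hg : Integrable ((Ioc 0 (b - a)).indicator fun s : ℝ => s ^ (1 - α)) := by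
    rw [integrable_indicator_iff measurableSet_Ioc,
      ← intervalIntegrable_iff_integrableOn_Ioc_of_le (by linarith)]
    exact intervalIntegral.intervalIntegrable_rpow' (by linarith)
  have hp' : Integrable ((Ioc a b).indicator p) := hp.integrable_indicator measurableSet_Ioc
  -- The kernel is a convolution integrand of two `L¹` functions; the factor `v` is bounded on the
  -- compact interval.
  have hconv := hp'.convolution_integrand (ContinuousLinearMap.mul ℝ ℝ) hg
  obtain ⟨C, hC⟩ := isCompact_Icc.exists_bound_of_continuousOn (s := Icc a b) hv.continuousOn
  rw [Measure.prod_restrict]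
  have h1 : IntegrableOn (fun z : ℝ × ℝ => v z.1 * ContinuousLinearMap.mul ℝ ℝ
      ((Ioc a b).indicator p z.2) ((Ioc 0 (b - a)).indicator (fun s : ℝ => s ^ (1 - α)) (z.1 - z.2)))
      (Ioc a b ×ˢ Ioc a b) := by
    refine Integrable.bdd_mul (c := C) hconv.integrableOn
      (hv.comp continuous_fst).aestronglyMeasurable ?_
    filter_upwards [ae_restrict_mem (measurableSet_Ioc.prod measurableSet_Ioc)] with z hz
    exact hC _ (Ioc_subset_Icc_self hz.1)
  refine h1.congr ?_
  filter_upwards [ae_restrict_mem (measurableSet_Ioc.prod measurableSet_Ioc)] with z hz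
  obtain ⟨hz1, hz2⟩ := hz
  simp only [ContinuousLinearMap.mul_apply', indicator_of_mem hz2]
  by_cases h : z.2 < z.1
  · have h' : z.1 - z.2 ∈ Ioc 0 (b - a) := ⟨by linarith, by linarith [hz1.2, hz2.1]⟩
    rw [indicator_of_mem h', indicator_of_mem (by exact h)]
    ring
  · have h' : z.1 - z.2 ∉ Ioc 0 (b - a) := fun h' => h (by linarith [h'.1])
    rw [indicator_of_notMem h', indicator_of_notMem (by exact h)]
    simp

/-- The quadratic form of the one-sided singular kernel applied to a second derivative. -/
theorem integral_rpow_kernel_nonpos {a b α : ℝ} {v w p : ℝ → ℝ} (hab : a ≤ b)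
    (hα1 : 1 < α) (hα : α < 2)
    (hv : Continuous v) (hw : Continuous w) (hvw : ∀ x ∈ Ioo a b, HasDerivAt v (w x) x)
    (hwp : ∀ x ∈ Ioo a b, HasDerivAt w (p x) x)
    (hp : IntervalIntegrable p volume a b) (hvb : v b = 0) (hwa : w a = 0) :
    ∫ x in a..b, (∫ ξ in a..x, p ξ / (x - ξ) ^ (α - 1)) * v x ≤ 0 := by
  have hpI : IntegrableOn p (Ioc a b) :=
    (intervalIntegrable_iff_integrableOn_Ioc_of_le hab).1 hp
  set μ := (volume.restrict (Ioc a b)).prod (volume.restrict (Ioc a b)) with hμ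
  set ν := (volume : Measure ℝ).restrict (Ioi 0) with hν
  set T : Set (ℝ × ℝ) := {z : ℝ × ℝ | z.2 < z.1} with hT
  have hTm : MeasurableSet T := measurableSet_lt measurable_snd measurable_fst
  have hker : Integrable (fun z => T.indicator
      (fun z => (z.1 - z.2) ^ (1 - α) * (p z.2 * v z.1)) z) μ :=
    integrable_rpow_kernel hab hα hv hpI
  -- Integrating `F` over `t > 0` gives `Γ(α - 1)` times the singular kernel, by the Gamma integral
  -- with exponent `α - 1`.
  set F : ℝ × ℝ → ℝ → ℝ := fun z t => T.indicator
    (fun z => t ^ (α - 2) * Real.exp (-(z.1 - z.2) * t) * (p z.2 * v z.1)) z with hF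
  have hΓ : 0 < Real.Gamma (α - 1) := Real.Gamma_pos_of_pos (by linarith)
  have hexp : ∀ s : ℝ, 0 < s → ∫ t in Ioi 0, t ^ (α - 2) * Real.exp (-s * t)
      = s ^ (1 - α) * Real.Gamma (α - 1) := fun s hs => by
    have := Real.integral_rpow_mul_exp_neg_mul_Ioi (a := α - 1) (by linarith) hs
    rw [show α - 1 - 1 = α - 2 by ring] at this
    simp only [neg_mul]
    rw [this, one_div, Real.inv_rpow hs.le, ← Real.rpow_neg hs.le]
    ring_nf
  -- A non-integrable function would have integral `0`, whereas the value in `hexp` is positive.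
  have hexpi : ∀ s : ℝ, 0 < s →
      Integrable (fun t => t ^ (α - 2) * Real.exp (-s * t)) ν := fun s hs => by
    by_contra hcon
    have h0 := integral_undef hcon
    rw [hν, hexp s hs] at h0
    have : 0 < s ^ (1 - α) := Real.rpow_pos_of_pos hs _
    exact (mul_pos this hΓ).ne' h0
  have hpm : AEStronglyMeasurable (fun z : ℝ × ℝ => p z.2) μ :=
    hpI.aestronglyMeasurable.comp_snd
  have hFm : AEStronglyMeasurable (Function.uncurry F) (μ.prod ν) := by
    have h1 : AEStronglyMeasurable (fun q : (ℝ × ℝ) × ℝ => p q.1.2) (μ.prod ν) := hpm.comp_fst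
    have h2 : Measurable fun q : (ℝ × ℝ) × ℝ =>
        q.2 ^ (α - 2) * Real.exp (-(q.1.1 - q.1.2) * q.2) := by fun_prop
    have h3 : Measurable fun q : (ℝ × ℝ) × ℝ => v q.1.1 := by
      have := hv.measurable
      fun_prop
    have h4 := (h2.aestronglyMeasurable (μ := μ.prod ν)).mul
      (h1.mul (h3.aestronglyMeasurable (μ := μ.prod ν)))
    have h5 := h4.indicator (hTm.preimage measurable_fst)
    exact h5
  have hFint : Integrable (Function.uncurry F) (μ.prod ν) := by
    rw [integrable_prod_iff hFm]
    constructor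
    · refine Eventually.of_forall fun z => ?_
      by_cases hz : z ∈ T
      · simp only [Function.uncurry, hF, indicator_of_mem hz]
        exact (hexpi _ (sub_pos.2 hz)).mul_const _
      · simp only [Function.uncurry, hF, indicator_of_notMem hz]
        exact integrable_zero _ _ _
    -- The exponential factor is positive, so integrating `|F|` in `t` gives `Γ(α - 1)` times the
    -- absolute singular kernel, which is integrable by `hker`.
    · refine (hker.norm.const_mul (Real.Gamma (α - 1))).congr (Eventually.of_forall fun z => ?_)
      by_cases hz : z ∈ T
      · simp only [Function.uncurry, hF, indicator_of_mem hz]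
        have hs : 0 < z.1 - z.2 := sub_pos.2 hz
        have e : ∀ t ∈ Ioi (0 : ℝ), ‖t ^ (α - 2) * Real.exp (-(z.1 - z.2) * t) * (p z.2 * v z.1)‖
            = t ^ (α - 2) * Real.exp (-(z.1 - z.2) * t) * ‖p z.2 * v z.1‖ := fun t ht => by
          have : 0 ≤ t ^ (α - 2) := Real.rpow_nonneg (le_of_lt ht) _
          rw [norm_mul, Real.norm_of_nonneg (mul_nonneg this (Real.exp_pos _).le)]
        rw [hν, setIntegral_congr_fun measurableSet_Ioi e, integral_mul_const, hexp _ hs,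
          norm_mul ((z.1 - z.2) ^ (1 - α)), Real.norm_of_nonneg (Real.rpow_nonneg hs.le _)]
        ring
      · simp [Function.uncurry, hF, indicator_of_notMem hz]
  have hinner : ∀ z, ∫ t, F z t ∂ν = Real.Gamma (α - 1) * T.indicator
      (fun z => (z.1 - z.2) ^ (1 - α) * (p z.2 * v z.1)) z := fun z => by
    by_cases hz : z ∈ T
    · simp only [hF, indicator_of_mem hz]
      rw [integral_mul_const, hν, hexp _ (sub_pos.2 hz)]
      ring
    · simp [hF, indicator_of_notMem hz]
  have hrestr : ∀ x ∈ Ioc a b, ∀ k : ℝ → ℝ,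
      ∫ ξ in Ioc a b, T.indicator (fun z => k z.2) (x, ξ) = ∫ ξ in a..x, k ξ := by
    intro x hx k
    have : (fun ξ => T.indicator (fun z => k z.2) (x, ξ)) = (Iio x).indicator k := by
      ext ξ
      simp [indicator, hT]
    rw [this, setIntegral_indicator measurableSet_Iio, intervalIntegral.integral_of_le hx.1.le,
      integral_Ioc_eq_integral_Ioo]
    congr 2
    ext ξ
    simp only [mem_inter_iff, mem_Ioc, mem_Iio, mem_Ioo]
    exact ⟨fun h => ⟨h.1.1, h.2⟩, fun h => ⟨⟨h.1, h.2.le.trans hx.2⟩, h.2⟩⟩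
  have hlhs : ∫ z, ∫ t, F z t ∂ν ∂μ
      = Real.Gamma (α - 1) * ∫ x in a..b, (∫ ξ in a..x, p ξ / (x - ξ) ^ (α - 1)) * v x := by
    simp_rw [hinner]
    rw [integral_const_mul, hμ, integral_prod _ hker, intervalIntegral.integral_of_le hab]
    congr 1
    refine setIntegral_congr_fun measurableSet_Ioc fun x hx => ?_
    rw [← hrestr x hx, ← integral_mul_const]
    refine integral_congr_ae (Eventually.of_forall fun ξ => ?_)
    by_cases hz : (x, ξ) ∈ T
    · have hs : 0 < x - ξ := sub_pos.2 hz
      simp only [indicator_of_mem hz]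
      rw [show 1 - α = -(α - 1) by ring, Real.rpow_neg hs.le]
      ring
    · simp [indicator_of_notMem hz]
  -- In the other order of integration, each fixed `t` contributes `t^(α-2) ≥ 0` times an
  -- exponential form.
  have hrhs : ∫ t, ∫ z, F z t ∂μ ∂ν ≤ 0 := by
    refine integral_nonpos_of_ae ?_
    filter_upwards [hFint.prod_left_ae, ae_restrict_mem measurableSet_Ioi] with t hti ht
    have hti' : Integrable (fun z => F z t) μ := hti
    simp only [Pi.zero_apply]
    rw [hμ, integral_prod _ hti']
    have e : ∫ x in Ioc a b, ∫ ξ in Ioc a b, F (x, ξ) t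
        = t ^ (α - 2) * ∫ x in a..b, (∫ ξ in a..x, Real.exp (-t * (x - ξ)) * p ξ) * v x := by
      rw [intervalIntegral.integral_of_le hab, ← integral_const_mul]
      refine setIntegral_congr_fun measurableSet_Ioc fun x hx => ?_
      rw [← hrestr x hx, ← integral_mul_const, ← integral_const_mul]
      refine integral_congr_ae (Eventually.of_forall fun ξ => ?_)
      by_cases hz : (x, ξ) ∈ T
      · simp only [hF, indicator_of_mem hz]
        rw [show -(x - ξ) * t = -t * (x - ξ) by ring]
        ring
      · simp [hF, indicator_of_notMem hz]
    rw [e]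
    exact mul_nonpos_of_nonneg_of_nonpos (Real.rpow_nonneg (le_of_lt ht) _)
      (integral_exp_kernel_nonpos hab (le_of_lt ht) hv hw hvw hwp hp hvb hwa)
  rw [← integral_integral_swap hFint, hlhs] at hrhs
  by_contra hcon
  exact absurd hrhs (not_le.2 (mul_pos hΓ (not_le.1 hcon)))

/-! ### Caputo derivatives on an interval. -/

/-- Extension by zero turns interior data with zero boundary limits into continuous functions on the
whole space, as the fundamental theorem of calculus on the closed interval needs. -/
theorem continuous_indicator_of_tendsto_zero {X : Type*} [TopologicalSpace X] {s : Set X}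
    (hs : IsOpen s) {u : X → ℝ} (hu : ContinuousOn u s)
    (h0 : ∀ p ∈ frontier s, Tendsto u (𝓝[s] p) (𝓝 0)) : Continuous (s.indicator u) := by
  refine continuous_iff_continuousAt.2 fun p => ?_
  by_cases hp : p ∈ s
  · refine (hu.continuousAt (hs.mem_nhds hp)).congr ?_
    filter_upwards [hs.mem_nhds hp] with y hy
    rw [indicator_of_mem hy]
  · rw [ContinuousAt, indicator_of_notMem hp]
    by_cases hc : p ∈ closure s
    · intro W hW
      have h := h0 p ⟨hc, by rwa [hs.interior_eq]⟩ hW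
      rw [mem_map, mem_nhdsWithin_iff_eventually] at h
      rw [mem_map]
      filter_upwards [h] with y hy
      by_cases hys : y ∈ s
      · simpa [indicator_of_mem hys] using hy hys
      · simpa [indicator_of_notMem hys] using mem_of_mem_nhds hW
    · refine tendsto_const_nhds.congr' ?_
      filter_upwards [isClosed_closure.isOpen_compl.mem_nhds hc] with y hy
      rw [indicator_of_notMem fun h => hy (subset_closure h)]

theorem continuous_indicator_Ioo {a b : ℝ} (hab : a < b) {u : ℝ → ℝ}
    (hu : ContinuousOn u (Ioo a b)) (ha : Tendsto u (𝓝[>] a) (𝓝 0))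
    (hb : Tendsto u (𝓝[<] b) (𝓝 0)) : Continuous ((Ioo a b).indicator u) := by
  refine continuous_indicator_of_tendsto_zero isOpen_Ioo hu fun p hp => ?_
  rw [frontier_Ioo hab] at hp
  rcases hp with rfl | rfl
  · exact ha.mono_left (nhdsWithin_mono _ Ioo_subset_Ioi_self)
  · exact hb.mono_left (nhdsWithin_mono _ Ioo_subset_Iio_self)

theorem integral_caputoLeft_mul_nonpos {a b α : ℝ} {u : ℝ → ℝ} (hab : a < b)
    (hα1 : 1 < α) (hα2 : α ≤ 2) (hu : ContDiffOn ℝ 2 u (Ioo a b))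
    (ha : Tendsto u (𝓝[>] a) (𝓝 0)) (hb : Tendsto u (𝓝[<] b) (𝓝 0))
    (hda : Tendsto (deriv u) (𝓝[>] a) (𝓝 0)) (hdb : Tendsto (deriv u) (𝓝[<] b) (𝓝 0))
    (hp : α < 2 → IntervalIntegrable (iteratedDeriv 2 u) volume a b) :
    ∫ x in Ioo a b, caputoLeft α a u x * u x ≤ 0 := by
  have hdu : ContDiffOn ℝ 1 (deriv u) (Ioo a b) :=
    hu.deriv_of_isOpen isOpen_Ioo (by norm_num)
  set v := (Ioo a b).indicator u with hvdef
  set w := (Ioo a b).indicator (deriv u) with hwdef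
  have hv : Continuous v := continuous_indicator_Ioo hab hu.continuousOn ha hb
  have hw : Continuous w := continuous_indicator_Ioo hab hdu.continuousOn hda hdb
  have hind : ∀ (k : ℝ → ℝ), ∀ x ∈ Ioo a b, (Ioo a b).indicator k =ᶠ[𝓝 x] k := fun k x hx => by
    filter_upwards [isOpen_Ioo.mem_nhds hx] with y hy
    rw [indicator_of_mem hy]
  have hvw : ∀ x ∈ Ioo a b, HasDerivAt v (w x) x := fun x hx => by
    rw [hwdef, indicator_of_mem hx]
    exact (((hu.differentiableOn (by norm_num)).differentiableAt
      (isOpen_Ioo.mem_nhds hx)).hasDerivAt).congr_of_eventuallyEq (hind u x hx)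
  have hwp : ∀ x ∈ Ioo a b, HasDerivAt w (iteratedDeriv 2 u x) x := fun x hx => by
    rw [iteratedDeriv_succ, iteratedDeriv_one]
    exact (((hdu.differentiableOn (by norm_num)).differentiableAt
      (isOpen_Ioo.mem_nhds hx)).hasDerivAt).congr_of_eventuallyEq (hind _ x hx)
  have hva : v a = 0 := by simp [hvdef]
  have hvb : v b = 0 := by simp [hvdef]
  have hwa : w a = 0 := by simp [hwdef]
  rcases hα2.lt_or_eq with hα | rfl
  · have hker := integral_rpow_kernel_nonpos hab.le hα1 hα hv hw hvw hwp (hp hα) hvb hwa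
    rw [intervalIntegral.integral_of_le hab.le, integral_Ioc_eq_integral_Ioo] at hker
    have e : ∫ x in Ioo a b, caputoLeft α a u x * u x = (Real.Gamma (2 - α))⁻¹ *
        ∫ x in Ioo a b, (∫ ξ in a..x, iteratedDeriv 2 u ξ / (x - ξ) ^ (α - 1)) * v x := by
      rw [← integral_const_mul]
      refine setIntegral_congr_fun measurableSet_Ioo fun x hx => ?_
      simp only [caputoLeft, if_neg hα.ne, hvdef, indicator_of_mem hx]
      ring
    rw [e]
    exact mul_nonpos_of_nonneg_of_nonpos
      (inv_nonneg.2 (Real.Gamma_pos_of_pos (by linarith)).le) hker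
  · have e : ∫ x in Ioo a b, caputoLeft 2 a u x * u x
        = ∫ x in Ioo a b, iteratedDeriv 2 u x * v x := by
      refine setIntegral_congr_fun measurableSet_Ioo fun x hx => ?_
      simp only [caputoLeft, if_true, hvdef, indicator_of_mem hx]
    rw [e]
    -- For `α = 2` no integrability of `u''` is assumed. If `u'' u` is integrable, integration by
    -- parts gives `-∫ u'²`; otherwise the integral is `0` by convention.
    by_cases hi : IntegrableOn (fun x => iteratedDeriv 2 u x * v x) (Ioo a b)
    · have hi' : IntervalIntegrable (fun x => iteratedDeriv 2 u x * v x) volume a b :=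
        (intervalIntegrable_iff_integrableOn_Ioo_of_le hab.le).2 hi
      have hw2 : IntervalIntegrable (fun x => w x * w x) volume a b :=
        Continuous.intervalIntegrable (by fun_prop) _ _
      have ftc := intervalIntegral.integral_eq_sub_of_hasDerivAt_of_le hab.le
        (f := fun x => w x * v x) (by fun_prop)
        (fun x hx => (hwp x hx).mul (hvw x hx)) (hi'.add hw2)
      rw [intervalIntegral.integral_add hi' hw2, hva, hvb] at ftc
      have hpos : 0 ≤ ∫ x in a..b, w x * w x :=
        intervalIntegral.integral_nonneg hab.le fun x _ => mul_self_nonneg _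
      rw [← integral_Ioc_eq_integral_Ioo, ← intervalIntegral.integral_of_le hab.le]
      linarith
    · rw [integral_undef hi]

/-- Second derivatives are invariant under reflection, so `x ↦ -x` exchanges the two sides and the
right-hand estimate follows from the left-hand one. -/
theorem caputoRight_eq_caputoLeft_neg (α b : ℝ) (u : ℝ → ℝ) (x : ℝ) :
    caputoRight α b u x = caputoLeft α (-b) (fun y => u (-y)) (-x) := by
  have e : ∀ y, iteratedDeriv 2 (fun y => u (-y)) y = iteratedDeriv 2 u (-y) := fun y => by
    simp [iteratedDeriv_comp_neg]
  unfold caputoRight caputoLeft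
  split_ifs
  · rw [e, neg_neg]
  · simp_rw [e]
    rw [← intervalIntegral.integral_comp_neg]
    congr 1
    refine intervalIntegral.integral_congr fun ξ _ => ?_
    rw [neg_neg, show -x - -ξ = ξ - x by ring]

theorem integral_caputoRight_mul_nonpos {a b α : ℝ} {u : ℝ → ℝ} (hab : a < b)
    (hα1 : 1 < α) (hα2 : α ≤ 2) (hu : ContDiffOn ℝ 2 u (Ioo a b))
    (ha : Tendsto u (𝓝[>] a) (𝓝 0)) (hb : Tendsto u (𝓝[<] b) (𝓝 0))
    (hda : Tendsto (deriv u) (𝓝[>] a) (𝓝 0)) (hdb : Tendsto (deriv u) (𝓝[<] b) (𝓝 0))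
    (hp : α < 2 → IntervalIntegrable (iteratedDeriv 2 u) volume a b) :
    ∫ x in Ioo a b, caputoRight α b u x * u x ≤ 0 := by
  have hd : deriv (fun y => u (-y)) = fun y => -deriv u (-y) := by
    ext y
    exact deriv_comp_neg ..
  have hIoi : Tendsto (fun y : ℝ => -y) (𝓝[>] (-b)) (𝓝[<] b) := by
    simpa using tendsto_neg_nhdsGT (a := -b)
  have hIio : Tendsto (fun y : ℝ => -y) (𝓝[<] (-a)) (𝓝[>] a) := by
    simpa using tendsto_neg_nhdsLT (a := -a)
  have key := integral_caputoLeft_mul_nonpos (a := -b) (b := -a) (α := α)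
    (u := fun y => u (-y)) (by linarith) hα1 hα2
    (hu.comp (contDiff_neg.contDiffOn) fun y hy => ⟨by linarith [hy.2], by linarith [hy.1]⟩)
    (hb.comp hIoi) (ha.comp hIio)
    (by rw [hd]; simpa using (hdb.comp hIoi).neg)
    (by rw [hd]; simpa using (hda.comp hIio).neg)
    (fun h => by
      have e : iteratedDeriv 2 (fun y => u (-y)) = fun y => iteratedDeriv 2 u (-y) := by
        ext y
        simp [iteratedDeriv_comp_neg]
      rw [e]
      simpa using (((hp h).comp_sub_left 0).symm))
  rw [← integral_Ioc_eq_integral_Ioo, ← intervalIntegral.integral_of_le (by linarith)] at key ⊢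
  simp_rw [caputoRight_eq_caputoLeft_neg]
  have := intervalIntegral.integral_comp_neg (a := -b) (b := -a)
    (fun x => caputoLeft α (-b) (fun y => u (-y)) (-x) * u x)
  simp only [neg_neg] at this
  rw [← this]
  exact key

/-! ### Reduction to lines through the domain. -/

section Slices

variable {d : ℕ} {Ω : Set (Fin d → ℝ)}

theorem setOf_update_mem_eq_Ioo (hΩo : IsOpen Ω) (hΩc : Convex ℝ Ω)
    (hΩb : Bornology.IsBounded Ω) (l : Fin d) {x : Fin d → ℝ} (hx : x ∈ Ω) :
    {ξ : ℝ | Function.update x l ξ ∈ Ω} = Ioo (lower Ω l x) (upper Ω l x) := by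
  set S := {ξ : ℝ | Function.update x l ξ ∈ Ω} with hS
  have hne : S.Nonempty := ⟨x l, by simpa [hS] using hx⟩
  have hSo : IsOpen S := hΩo.preimage (continuous_const.update l continuous_id)
  have hbdd : Bornology.IsBounded S := by
    have hsub : S ⊆ (fun y : Fin d → ℝ => y l) '' Ω := fun ξ hξ => ⟨_, hξ, by simp⟩
    exact ((LipschitzWith.eval l).isBounded_image hΩb).subset hsub
  have hconv : Convex ℝ S := by
    intro ξ hξ η hη p q hp hq hpq
    have := hΩc hξ hη hp hq hpq
    simp only [hS, mem_ofPred_eq]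
    convert this using 1
    ext i
    by_cases hi : i = l
    · subst hi
      simp
    · simp [hi, ← add_mul, hpq]
  apply Subset.antisymm
  -- Being open, `S` lies in the interior of its closed hull, so neither end is attained.
  · have h1 : S ⊆ Icc (sInf S) (sSup S) := subset_Icc_csInf_csSup hbdd.bddBelow hbdd.bddAbove
    have h2 := interior_maximal h1 hSo
    rwa [interior_Icc] at h2
  · intro ξ hξ
    obtain ⟨y, hy, hyξ⟩ := exists_lt_of_csInf_lt hne hξ.1
    obtain ⟨z, hz, hξz⟩ := exists_lt_of_lt_csSup hne hξ.2
    exact hconv.ordConnected.out hy hz ⟨hyξ.le, hξz.le⟩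

theorem lower_lt_and_lt_upper (hΩo : IsOpen Ω) (hΩc : Convex ℝ Ω)
    (hΩb : Bornology.IsBounded Ω) (l : Fin d) {x : Fin d → ℝ} (hx : x ∈ Ω) :
    lower Ω l x < x l ∧ x l < upper Ω l x := by
  have h : x l ∈ {ξ : ℝ | Function.update x l ξ ∈ Ω} := by simpa using hx
  rwa [setOf_update_mem_eq_Ioo hΩo hΩc hΩb l hx] at h

theorem update_mem_iff (hΩo : IsOpen Ω) (hΩc : Convex ℝ Ω)
    (hΩb : Bornology.IsBounded Ω) (l : Fin d) {x : Fin d → ℝ} (hx : x ∈ Ω) (ξ : ℝ) :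
    Function.update x l ξ ∈ Ω ↔ ξ ∈ Ioo (lower Ω l x) (upper Ω l x) := by
  rw [← setOf_update_mem_eq_Ioo hΩo hΩc hΩb l hx]
  rfl

/-- An accumulation point of a slice that lies outside `Ω` is a boundary point, approached from
inside `Ω`. -/
theorem update_mem_frontier (hΩo : IsOpen Ω) {l : Fin d} {x : Fin d → ℝ} {c : ℝ} {F : Filter ℝ}
    [F.NeBot] (hF : F ≤ 𝓝 c) (hc : Function.update x l c ∉ Ω)
    (hev : ∀ᶠ ξ in F, Function.update x l ξ ∈ Ω) :
    Function.update x l c ∈ frontier Ω ∧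
      Tendsto (Function.update x l) F (𝓝[Ω] (Function.update x l c)) := by
  have hcont : Continuous (Function.update x l) := continuous_const.update l continuous_id
  have ht : Tendsto (Function.update x l) F (𝓝 (Function.update x l c)) :=
    hcont.continuousAt.tendsto.mono_left hF
  exact ⟨⟨mem_closure_of_tendsto ht hev, by rwa [hΩo.interior_eq]⟩,
    tendsto_nhdsWithin_iff.2 ⟨ht, hev⟩⟩

theorem deriv_slice {u : (Fin d → ℝ) → ℝ} {l : Fin d} {x : Fin d → ℝ} {ξ : ℝ}
    (hu : DifferentiableAt ℝ u (Function.update x l ξ)) :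
    deriv (slice u l x) ξ = fderiv ℝ u (Function.update x l ξ) (Pi.single l 1) :=
  (hu.hasFDerivAt.comp_hasDerivAt ξ (hasDerivAt_update x l ξ)).deriv

/-- The slice derivative is the gradient applied to a fixed vector, so both boundary conditions pass
to the ends of every line. -/
theorem tendsto_slice {u : (Fin d → ℝ) → ℝ} (hΩo : IsOpen Ω)
    (hu : DifferentiableOn ℝ u Ω) (hu0 : ∀ p ∈ frontier Ω, Tendsto u (𝓝[Ω] p) (𝓝 0))
    (hgrad : ZeroBoundaryGradient Ω u) {l : Fin d} {x : Fin d → ℝ} {c : ℝ} {F : Filter ℝ}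
    [F.NeBot] (hF : F ≤ 𝓝 c) (hc : Function.update x l c ∉ Ω)
    (hev : ∀ᶠ ξ in F, Function.update x l ξ ∈ Ω) :
    Tendsto (slice u l x) F (𝓝 0) ∧ Tendsto (deriv (slice u l x)) F (𝓝 0) := by
  obtain ⟨hfr, ht⟩ := update_mem_frontier hΩo hF hc hev
  refine ⟨(hu0 _ hfr).comp ht, ?_⟩
  have h1 := ((ContinuousLinearMap.apply ℝ ℝ (Pi.single l 1 : Fin d → ℝ)).continuous.tendsto
    0).comp ((hgrad _ hfr).comp ht)
  rw [map_zero] at h1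
  refine h1.congr' ?_
  filter_upwards [hev] with ξ hξ
  exact (deriv_slice (hu.differentiableAt (hΩo.mem_nhds hξ))).symm

theorem contDiffAt_slice {u : (Fin d → ℝ) → ℝ} (hΩo : IsOpen Ω) (hu : ContDiffOn ℝ 2 u Ω)
    {l : Fin d} {x : Fin d → ℝ} {ξ : ℝ} (hξ : Function.update x l ξ ∈ Ω) :
    ContDiffAt ℝ 2 (slice u l x) ξ :=
  (hu.contDiffAt (hΩo.mem_nhds hξ)).comp ξ (contDiff_update 2 x l).contDiffAt

theorem slice_update (u : (Fin d → ℝ) → ℝ) (l : Fin d) (x : Fin d → ℝ) (ξ : ℝ) :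
    slice u l (Function.update x l ξ) = slice u l x := by
  ext η
  simp [slice]

theorem lower_update (Ω : Set (Fin d → ℝ)) (l : Fin d) (x : Fin d → ℝ) (ξ : ℝ) :
    lower Ω l (Function.update x l ξ) = lower Ω l x := by
  simp [lower]

theorem upper_update (Ω : Set (Fin d → ℝ)) (l : Fin d) (x : Fin d → ℝ) (ξ : ℝ) :
    upper Ω l (Function.update x l ξ) = upper Ω l x := by
  simp [upper]

/-- Absolute convergence at the single point `x` suffices: multiplying by the continuous weight
`|x_l - ξ|^(α_l - 1)` undoes the division on each side of `x`. -/
theorem HasFracDerivs.intervalIntegrable_slice {α : Fin d → ℝ} {u : (Fin d → ℝ) → ℝ}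
    (hu : HasFracDerivs Ω α u) (hΩo : IsOpen Ω) (hΩc : Convex ℝ Ω)
    (hΩb : Bornology.IsBounded Ω) {l : Fin d} (h1 : 1 < α l) (h2 : α l < 2)
    {x : Fin d → ℝ} (hx : x ∈ Ω) :
    IntervalIntegrable (iteratedDeriv 2 (slice u l x)) volume (lower Ω l x) (upper Ω l x) := by
  obtain ⟨ha, hb⟩ := lower_lt_and_lt_upper hΩo hΩc hΩb l hx
  have hc : Continuous fun s : ℝ => s ^ (α l - 1) := Real.continuous_rpow_const (by linarith)
  refine IntervalIntegrable.trans (b := x l) ?_ ?_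
  · have h := (hu.left_conv l h2 x hx).mul_continuousOn
      (g := fun ξ => (x l - ξ) ^ (α l - 1)) (by fun_prop)
    refine h.congr_uIoo fun ξ hξ => ?_
    rw [uIoo_of_le ha.le] at hξ
    exact div_mul_cancel₀ _ (Real.rpow_pos_of_pos (sub_pos.2 hξ.2) _).ne'
  · have h := (hu.right_conv l h2 x hx).mul_continuousOn
      (g := fun ξ => (ξ - x l) ^ (α l - 1)) (by fun_prop)
    refine h.congr_uIoo fun ξ hξ => ?_
    rw [uIoo_of_le hb.le] at hξ
    exact div_mul_cancel₀ _ (Real.rpow_pos_of_pos (sub_pos.2 hξ.1) _).ne'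

/-- Along each line, the fractional derivatives are negative semidefinite on functions vanishing
to first order at the boundary. -/
theorem HasFracDerivs.integral_slice_nonpos {α : Fin d → ℝ} {u : (Fin d → ℝ) → ℝ}
    (hu : HasFracDerivs Ω α u) (hΩo : IsOpen Ω) (hΩc : Convex ℝ Ω)
    (hΩb : Bornology.IsBounded Ω) {l : Fin d} (h1 : 1 < α l) (h2 : α l ≤ 2)
    (hu0 : ∀ p ∈ frontier Ω, Tendsto u (𝓝[Ω] p) (𝓝 0)) (hgrad : ZeroBoundaryGradient Ω u)
    {x : Fin d → ℝ} (hx : x ∈ Ω) :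
    (∫ ξ in {ξ : ℝ | Function.update x l ξ ∈ Ω},
      fracLeft Ω (α l) l u (Function.update x l ξ) * u (Function.update x l ξ) ≤ 0) ∧
    ∫ ξ in {ξ : ℝ | Function.update x l ξ ∈ Ω},
      fracRight Ω (α l) l u (Function.update x l ξ) * u (Function.update x l ξ) ≤ 0 := by
  obtain ⟨ha, hb⟩ := lower_lt_and_lt_upper hΩo hΩc hΩb l hx
  have hab := ha.trans hb
  have hmem := update_mem_iff hΩo hΩc hΩb l hx
  have hdiff : DifferentiableOn ℝ u Ω := hu.contDiffOn.differentiableOn (by norm_num)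
  obtain ⟨ta, tda⟩ := tendsto_slice hΩo hdiff hu0 hgrad (F := 𝓝[>] (lower Ω l x))
    (c := lower Ω l x) (l := l) (x := x) nhdsWithin_le_nhds
    (fun h => lt_irrefl _ ((hmem _).1 h).1) (by
      filter_upwards [Ioo_mem_nhdsGT hab] with ξ hξ using (hmem ξ).2 hξ)
  obtain ⟨tb, tdb⟩ := tendsto_slice hΩo hdiff hu0 hgrad (F := 𝓝[<] (upper Ω l x))
    (c := upper Ω l x) (l := l) (x := x) nhdsWithin_le_nhds
    (fun h => lt_irrefl _ ((hmem _).1 h).2) (by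
      filter_upwards [Ioo_mem_nhdsLT hab] with ξ hξ using (hmem ξ).2 hξ)
  have hcd : ContDiffOn ℝ 2 (slice u l x) (Ioo (lower Ω l x) (upper Ω l x)) := fun ξ hξ =>
    (contDiffAt_slice hΩo hu.contDiffOn ((hmem ξ).2 hξ)).contDiffWithinAt
  have hint := fun h => hu.intervalIntegrable_slice hΩo hΩc hΩb h1 h hx
  rw [setOf_update_mem_eq_Ioo hΩo hΩc hΩb l hx]
  simp only [fracLeft, fracRight, slice_update, lower_update, upper_update, Function.update_self]
  exact ⟨integral_caputoLeft_mul_nonpos hab h1 h2 hcd ta tb tda tdb hint,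
    integral_caputoRight_mul_nonpos hab h1 h2 hcd ta tb tda tdb hint⟩

/-- Fubini: a function whose integrals over all lines of one direction are nonpositive has a
nonpositive integral. -/
theorem setIntegral_nonpos_of_slices (hΩ : MeasurableSet Ω) {F : (Fin d → ℝ) → ℝ}
    (hF : IntegrableOn F Ω) (l : Fin d)
    (h : ∀ x ∈ Ω, ∫ ξ in {ξ : ℝ | Function.update x l ξ ∈ Ω}, F (Function.update x l ξ) ≤ 0) :
    ∫ x in Ω, F x ≤ 0 := by
  cases d with
  | zero => exact l.elim0
  | succ n =>
    have hmp := (volume_preserving_piFinSuccAbove (fun _ : Fin (n + 1) => ℝ) l).symm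
    have hF' : Integrable (Ω.indicator F) := hF.integrable_indicator hΩ
    rw [← integral_indicator hΩ, ← hmp.integral_comp' (Ω.indicator F)]
    have hint : Integrable (fun z => Ω.indicator F
        ((MeasurableEquiv.piFinSuccAbove (fun _ : Fin (n + 1) => ℝ) l).symm z)) volume := (hmp.integrable_comp_emb (MeasurableEquiv.measurableEmbedding _)).2 hF'
    rw [Measure.volume_eq_prod, integral_prod_symm _ hint]
    refine integral_nonpos fun y => ?_
    rw [MeasurableEquiv.piFinSuccAbove_symm_apply]
    change ∫ ξ : ℝ, Ω.indicator F (l.insertNth (α := fun _ => ℝ) ξ y) ≤ 0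
    -- The hypothesis speaks of lines through points of `Ω`, so a line meeting `Ω` is based at such
    -- a point; on any other line the integrand is zero.
    by_cases hy : ∃ η : ℝ, l.insertNth (α := fun _ => ℝ) η y ∈ Ω
    · obtain ⟨η, hη⟩ := hy
      have key := h _ hη
      simp only [Fin.update_insertNth] at key
      rw [← integral_indicator] at key
      · exact key
      · have hc : Continuous (Function.update (l.insertNth (α := fun _ => ℝ) η y) l) :=
          continuous_const.update l continuous_id
        simpa [preimage, Fin.update_insertNth] using hc.measurable hΩ
    · push Not at hy
      simp_rw [indicator_of_notMem (hy _), integral_zero, le_refl]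

end Slices

/-! ### Error equation and energy estimate. -/

section Energy

variable {d : ℕ} {Ω : Set (Fin d → ℝ)} {α : Fin d → ℝ} {u v : (Fin d → ℝ) → ℝ}

theorem iteratedDeriv_slice_sub (hΩo : IsOpen Ω) (hu : ContDiffOn ℝ 2 u Ω)
    (hv : ContDiffOn ℝ 2 v Ω) {l : Fin d} {x : Fin d → ℝ} {ξ : ℝ}
    (hξ : Function.update x l ξ ∈ Ω) :
    iteratedDeriv 2 (slice (fun x => u x - v x) l x) ξ
      = iteratedDeriv 2 (slice u l x) ξ - iteratedDeriv 2 (slice v l x) ξ :=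
  iteratedDeriv_fun_sub (contDiffAt_slice hΩo hu hξ) (contDiffAt_slice hΩo hv hξ)

/-- Equality is claimed only on the open interval: the lower end lies outside `Ω`, where nothing is
known about `u` and `v`. -/
theorem eqOn_left_integrand_sub (hΩo : IsOpen Ω) (hΩc : Convex ℝ Ω)
    (hΩb : Bornology.IsBounded Ω) (hu : HasFracDerivs Ω α u) (hv : HasFracDerivs Ω α v)
    (l : Fin d) {x : Fin d → ℝ} (hx : x ∈ Ω) :
    EqOn (fun ξ => iteratedDeriv 2 (slice u l x) ξ / (x l - ξ) ^ (α l - 1)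
        - iteratedDeriv 2 (slice v l x) ξ / (x l - ξ) ^ (α l - 1))
      (fun ξ => iteratedDeriv 2 (slice (fun x => u x - v x) l x) ξ / (x l - ξ) ^ (α l - 1))
      (uIoo (lower Ω l x) (x l)) := fun ξ hξ => by
  obtain ⟨ha, hb⟩ := lower_lt_and_lt_upper hΩo hΩc hΩb l hx
  rw [uIoo_of_le ha.le] at hξ
  simp only
  rw [iteratedDeriv_slice_sub hΩo hu.contDiffOn hv.contDiffOn
    ((update_mem_iff hΩo hΩc hΩb l hx ξ).2 ⟨hξ.1, hξ.2.trans hb⟩), sub_div]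

theorem eqOn_right_integrand_sub (hΩo : IsOpen Ω) (hΩc : Convex ℝ Ω)
    (hΩb : Bornology.IsBounded Ω) (hu : HasFracDerivs Ω α u) (hv : HasFracDerivs Ω α v)
    (l : Fin d) {x : Fin d → ℝ} (hx : x ∈ Ω) :
    EqOn (fun ξ => iteratedDeriv 2 (slice u l x) ξ / (ξ - x l) ^ (α l - 1)
        - iteratedDeriv 2 (slice v l x) ξ / (ξ - x l) ^ (α l - 1))
      (fun ξ => iteratedDeriv 2 (slice (fun x => u x - v x) l x) ξ / (ξ - x l) ^ (α l - 1))
      (uIoo (x l) (upper Ω l x)) := fun ξ hξ => by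
  obtain ⟨ha, hb⟩ := lower_lt_and_lt_upper hΩo hΩc hΩb l hx
  rw [uIoo_of_le hb.le] at hξ
  simp only
  rw [iteratedDeriv_slice_sub hΩo hu.contDiffOn hv.contDiffOn
    ((update_mem_iff hΩo hΩc hΩb l hx ξ).2 ⟨ha.trans hξ.1, hξ.2⟩), sub_div]

/-- For `α_l < 2`, splitting the integral relies on the absolute convergence of both parts at `x`.
-/
theorem fracLeft_sub (hΩo : IsOpen Ω) (hΩc : Convex ℝ Ω) (hΩb : Bornology.IsBounded Ω)
    (hu : HasFracDerivs Ω α u) (hv : HasFracDerivs Ω α v) {l : Fin d} (hα : α l ≤ 2)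
    {x : Fin d → ℝ} (hx : x ∈ Ω) :
    fracLeft Ω (α l) l (fun x => u x - v x) x
      = fracLeft Ω (α l) l u x - fracLeft Ω (α l) l v x := by
  unfold fracLeft caputoLeft
  split_ifs with h
  · exact iteratedDeriv_slice_sub hΩo hu.contDiffOn hv.contDiffOn (by simpa using hx)
  · have hlt : α l < 2 := lt_of_le_of_ne hα h
    rw [← intervalIntegral.integral_congr_uIoo
      (eqOn_left_integrand_sub hΩo hΩc hΩb hu hv l hx),
      intervalIntegral.integral_sub (hu.left_conv l hlt x hx) (hv.left_conv l hlt x hx), mul_sub]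

theorem fracRight_sub (hΩo : IsOpen Ω) (hΩc : Convex ℝ Ω) (hΩb : Bornology.IsBounded Ω)
    (hu : HasFracDerivs Ω α u) (hv : HasFracDerivs Ω α v) {l : Fin d} (hα : α l ≤ 2)
    {x : Fin d → ℝ} (hx : x ∈ Ω) :
    fracRight Ω (α l) l (fun x => u x - v x) x
      = fracRight Ω (α l) l u x - fracRight Ω (α l) l v x := by
  unfold fracRight caputoRight
  split_ifs with h
  · exact iteratedDeriv_slice_sub hΩo hu.contDiffOn hv.contDiffOn (by simpa using hx)
  · have hlt : α l < 2 := lt_of_le_of_ne hα h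
    rw [← intervalIntegral.integral_congr_uIoo
      (eqOn_right_integrand_sub hΩo hΩc hΩb hu hv l hx),
      intervalIntegral.integral_sub (hu.right_conv l hlt x hx) (hv.right_conv l hlt x hx), mul_sub]

theorem HasFracDerivs.sub (hΩo : IsOpen Ω) (hΩc : Convex ℝ Ω) (hΩb : Bornology.IsBounded Ω)
    (hα : ∀ l, α l ≤ 2) (hu : HasFracDerivs Ω α u) (hv : HasFracDerivs Ω α v) :
    HasFracDerivs Ω α (fun x => u x - v x) where
  contDiffOn := hu.contDiffOn.sub hv.contDiffOn
  left_conv l hl x hx := ((hu.left_conv l hl x hx).sub (hv.left_conv l hl x hx)).congr_uIoo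
    (eqOn_left_integrand_sub hΩo hΩc hΩb hu hv l hx)
  right_conv l hl x hx := ((hu.right_conv l hl x hx).sub (hv.right_conv l hl x hx)).congr_uIoo
    (eqOn_right_integrand_sub hΩo hΩc hΩb hu hv l hx)
  left_memLp l := ((hu.left_memLp l).sub (hv.left_memLp l)).ae_eq <| by
    filter_upwards [ae_restrict_mem hΩo.measurableSet] with x hx
    exact (fracLeft_sub hΩo hΩc hΩb hu hv (hα l) hx).symm
  right_memLp l := ((hu.right_memLp l).sub (hv.right_memLp l)).ae_eq <| by
    filter_upwards [ae_restrict_mem hΩo.measurableSet] with x hx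
    exact (fracRight_sub hΩo hΩc hΩb hu hv (hα l) hx).symm

theorem HasFracDerivs.inner0_nonpos (hu : HasFracDerivs Ω α u)
    (hu2 : MemLp u 2 (volume.restrict Ω)) (hΩo : IsOpen Ω) (hΩc : Convex ℝ Ω)
    (hΩb : Bornology.IsBounded Ω) {l : Fin d} (h1 : 1 < α l) (h2 : α l ≤ 2)
    (hu0 : ∀ p ∈ frontier Ω, Tendsto u (𝓝[Ω] p) (𝓝 0)) (hgrad : ZeroBoundaryGradient Ω u) :
    inner0 Ω (fracLeft Ω (α l) l u) u ≤ 0 ∧ inner0 Ω (fracRight Ω (α l) l u) u ≤ 0 :=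
  ⟨setIntegral_nonpos_of_slices hΩo.measurableSet ((hu.left_memLp l).integrable_mul hu2) l
      fun _ hx => (hu.integral_slice_nonpos hΩo hΩc hΩb h1 h2 hu0 hgrad hx).1,
    setIntegral_nonpos_of_slices hΩo.measurableSet ((hu.right_memLp l).integrable_mul hu2) l
      fun _ hx => (hu.integral_slice_nonpos hΩo hΩc hΩb h1 h2 hu0 hgrad hx).2⟩

theorem inner0_le (hu : MemLp u 2 (volume.restrict Ω)) (hv : MemLp v 2 (volume.restrict Ω)) :
    inner0 Ω u v ≤ (inner0 Ω u u + inner0 Ω v v) / 2 := by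
  have huu : IntegrableOn (fun x => u x * u x) Ω := hu.integrable_mul hu
  have hvv : IntegrableOn (fun x => v x * v x) Ω := hv.integrable_mul hv
  have huv : IntegrableOn (fun x => u x * v x) Ω := hu.integrable_mul hv
  unfold inner0
  rw [← integral_add huu hvv, ← integral_div]
  refine integral_mono huv ((huu.add hvv).div_const 2) fun x => ?_
  beta_reduce
  nlinarith [sq_nonneg (u x - v x)]

/-- Subtracting the scheme equations of two solutions, with the history terms collected in the
multipliers of `U (n - k)` and `U 0`. -/
theorem SchemeEq.sub {s : ℕ} {a θ : Fin s → ℝ} {εp εm : Fin d → ℝ}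
    {f : (Fin d → ℝ) → ℝ → ℝ} {τ : ℝ} {U V : ℕ → (Fin d → ℝ) → ℝ} {n : ℕ} {x : Fin d → ℝ}
    (hU : SchemeEq Ω a θ α εp εm f τ U n x) (hV : SchemeEq Ω a θ α εp εm f τ V n x)
    (hL : ∀ l, fracLeft Ω (α l) l (fun x => U n x - V n x) x
      = fracLeft Ω (α l) l (U n) x - fracLeft Ω (α l) l (V n) x)
    (hR : ∀ l, fracRight Ω (α l) l (fun x => U n x - V n x) x
      = fracRight Ω (α l) l (U n) x - fracRight Ω (α l) l (V n) x) :
    (∑ r, a r / τ ^ θ r) * (U n x - V n x)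
      = ∑ l, εp l * fracLeft Ω (α l) l (fun x => U n x - V n x) x
        + ∑ l, εm l * fracRight Ω (α l) l (fun x => U n x - V n x) x
        + ∑ k ∈ Finset.Ico 1 n, (∑ r, a r / τ ^ θ r * -omega (θ r) k) * (U (n - k) x - V (n - k) x)
        + (∑ r, a r / τ ^ θ r * ∑ k ∈ Finset.range n, omega (θ r) k) * (U 0 x - V 0 x) := by
  have hist : ∀ W : ℕ → (Fin d → ℝ) → ℝ,
      ∑ k ∈ Finset.Ico 1 n, (∑ r, a r / τ ^ θ r * -omega (θ r) k) * W (n - k) x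
        = -∑ r, a r / τ ^ θ r * ∑ k ∈ Finset.Ico 1 n, omega (θ r) k * W (n - k) x := fun W => by
    simp_rw [Finset.sum_mul, Finset.mul_sum]
    rw [Finset.sum_comm, ← Finset.sum_neg_distrib]
    refine Finset.sum_congr rfl fun r _ => ?_
    rw [← Finset.sum_neg_distrib]
    exact Finset.sum_congr rfl fun k _ => by ring
  have init : ∀ W : ℕ → (Fin d → ℝ) → ℝ,
      (∑ r, a r / τ ^ θ r * ∑ k ∈ Finset.range n, omega (θ r) k) * W 0 x
        = ∑ r, a r / τ ^ θ r * ∑ k ∈ Finset.range n, omega (θ r) k * W 0 x := fun W => by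
    simp_rw [Finset.sum_mul, mul_assoc, Finset.sum_mul]
  unfold SchemeEq at hU hV
  simp only [omega_zero, mul_one] at hU hV
  simp only [hL, hR, mul_sub, Finset.sum_sub_distrib]
  rw [hist U, hist V, init U, init V]
  linear_combination hU - hV

/-- One step of the energy estimate. -/
theorem inner0_self_le_of_step {n : ℕ} {A Z B : ℝ} {W : ℕ → ℝ} {e : ℕ → (Fin d → ℝ) → ℝ}
    {εp εm : Fin d → ℝ} (hΩo : IsOpen Ω) (hΩc : Convex ℝ Ω) (hΩb : Bornology.IsBounded Ω)
    (hα : ∀ l, 1 < α l ∧ α l ≤ 2) (hεp : ∀ l, 0 ≤ εp l) (hεm : ∀ l, 0 ≤ εm l)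
    (hA : 0 < A) (hZ : 0 ≤ Z) (hW : ∀ k ∈ Finset.Ico 1 n, 0 ≤ W k)
    (hsum : ∑ k ∈ Finset.Ico 1 n, W k + Z = A)
    (he : HasFracDerivs Ω α (e n)) (he2 : ∀ m ≤ n, MemLp (e m) 2 (volume.restrict Ω))
    (he0 : ∀ p ∈ frontier Ω, Tendsto (e n) (𝓝[Ω] p) (𝓝 0))
    (hgrad : ZeroBoundaryGradient Ω (e n))
    (heq : ∀ x ∈ Ω, A * e n x = ∑ l, εp l * fracLeft Ω (α l) l (e n) x
      + ∑ l, εm l * fracRight Ω (α l) l (e n) x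
      + ∑ k ∈ Finset.Ico 1 n, W k * e (n - k) x + Z * e 0 x)
    (hB : ∀ m < n, inner0 Ω (e m) (e m) ≤ B) (hn : 1 ≤ n) :
    inner0 Ω (e n) (e n) ≤ B := by
  have hnn := he2 n le_rfl
  have iL : ∀ l, IntegrableOn (fun x => fracLeft Ω (α l) l (e n) x * e n x) Ω := fun l =>
    (he.left_memLp l).integrable_mul hnn
  have iR : ∀ l, IntegrableOn (fun x => fracRight Ω (α l) l (e n) x * e n x) Ω := fun l =>
    (he.right_memLp l).integrable_mul hnn
  have iE : ∀ m ≤ n, IntegrableOn (fun x => e m x * e n x) Ω := fun m hm =>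
    (he2 m hm).integrable_mul hnn
  -- The error equation tested with `e n`.
  have hint : A * inner0 Ω (e n) (e n)
      = ∑ l, εp l * inner0 Ω (fracLeft Ω (α l) l (e n)) (e n)
        + ∑ l, εm l * inner0 Ω (fracRight Ω (α l) l (e n)) (e n)
        + ∑ k ∈ Finset.Ico 1 n, W k * inner0 Ω (e (n - k)) (e n)
        + Z * inner0 Ω (e 0) (e n) := by
    unfold inner0
    simp only [← integral_const_mul]
    have j1 := fun l (_ : l ∈ Finset.univ) => (iL l).const_mul (εp l)
    have j2 := fun l (_ : l ∈ Finset.univ) => (iR l).const_mul (εm l)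
    have j3 := fun k (_ : k ∈ Finset.Ico 1 n) => (iE (n - k) (Nat.sub_le n k)).const_mul (W k)
    have j4 := (iE 0 (Nat.zero_le n)).const_mul Z
    have i1 := integrable_finsetSum _ j1
    have i2 := integrable_finsetSum _ j2
    have i3 := integrable_finsetSum _ j3
    rw [← integral_finsetSum _ j1, ← integral_finsetSum _ j2, ← integral_finsetSum _ j3,
      ← integral_add i1 i2, ← integral_add (i1.fun_add i2) i3,
      ← integral_add ((i1.fun_add i2).fun_add i3) j4]
    refine setIntegral_congr_fun hΩo.measurableSet fun x hx => ?_
    simp only [← mul_assoc]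
    rw [heq x hx]
    simp only [add_mul, Finset.sum_mul]
  have hneg := fun l =>
    he.inner0_nonpos hnn hΩo hΩc hΩb (hα l).1 (hα l).2 he0 hgrad
  have n1 : ∑ l, εp l * inner0 Ω (fracLeft Ω (α l) l (e n)) (e n) ≤ 0 :=
    Finset.sum_nonpos fun l _ => mul_nonpos_of_nonneg_of_nonpos (hεp l) (hneg l).1
  have n2 : ∑ l, εm l * inner0 Ω (fracRight Ω (α l) l (e n)) (e n) ≤ 0 :=
    Finset.sum_nonpos fun l _ => mul_nonpos_of_nonneg_of_nonpos (hεm l) (hneg l).2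
  have bound : ∀ m < n, inner0 Ω (e m) (e n) ≤ (B + inner0 Ω (e n) (e n)) / 2 := fun m hm =>
    (inner0_le (he2 m hm.le) hnn).trans (by linarith [hB m hm])
  have n3 : ∑ k ∈ Finset.Ico 1 n, W k * inner0 Ω (e (n - k)) (e n)
      ≤ (∑ k ∈ Finset.Ico 1 n, W k) * ((B + inner0 Ω (e n) (e n)) / 2) := by
    rw [Finset.sum_mul]
    refine Finset.sum_le_sum fun k hk => mul_le_mul_of_nonneg_left (bound _ ?_) (hW k hk)
    have := (Finset.mem_Ico.1 hk).1
    lia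
  have n4 := mul_le_mul_of_nonneg_left (bound 0 hn) hZ
  -- As the weights sum to `A`, the quantity `X = ‖e n‖²` satisfies `A X ≤ A (B + X)/2`, hence `X ≤
  -- B`.
  have total : A * inner0 Ω (e n) (e n) ≤ A * ((B + inner0 Ω (e n) (e n)) / 2) := by
    rw [hint, ← hsum, add_mul]
    linarith
  have := le_of_mul_le_mul_left total hA
  linarith

end Energy

end FracScheme

end

/-! ### Unconditional stability. -/

theorem theorem4p1 (d : ℕ) (Ω : Set (Fin d → ℝ))
    (hΩo : IsOpen Ω) (hΩc : Convex ℝ Ω) (hΩb : Bornology.IsBounded Ω)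
    (s : ℕ) (hs : 0 < s) (a θ : Fin s → ℝ)
    (ha₁ : 0 < a ⟨0, hs⟩) (ha : ∀ r, 0 ≤ a r)
    (hθ : ∀ r, 0 < θ r ∧ θ r ≤ 1)
    (α εp εm : Fin d → ℝ)
    (hα : ∀ l, 1 < α l ∧ α l ≤ 2)
    (hεp : ∀ l, 0 ≤ εp l) (hεm : ∀ l, 0 ≤ εm l)
    (f g : (Fin d → ℝ) → ℝ → ℝ)
    (τ : ℝ) (hτ : 0 < τ) (N : ℕ)
    (U V : ℕ → (Fin d → ℝ) → ℝ)
    (hU : FracScheme.IsSchemeSolution Ω a θ α εp εm f g τ N U)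
    (hV : FracScheme.IsSchemeSolution Ω a θ α εp εm f g τ N V)
    (hgrad : ∀ n, 1 ≤ n → n ≤ N →
      FracScheme.ZeroBoundaryGradient Ω (fun x => U n x - V n x)) :
    ∀ n ≤ N, FracScheme.norm0 Ω (fun x => U n x - V n x)
      ≤ FracScheme.norm0 Ω (fun x => U 0 x - V 0 x) := by
  set c : Fin s → ℝ := fun r => a r / τ ^ θ r with hc
  have hc0 : ∀ r, 0 ≤ c r := fun r => div_nonneg (ha r) (Real.rpow_pos_of_pos hτ _).le
  have hA : 0 < ∑ r, c r := Finset.sum_pos' (fun r _ => hc0 r)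
    ⟨⟨0, hs⟩, Finset.mem_univ _, div_pos ha₁ (Real.rpow_pos_of_pos hτ _)⟩
  suffices h : ∀ n ≤ N, FracScheme.inner0 Ω (fun x => U n x - V n x) (fun x => U n x - V n x)
      ≤ FracScheme.inner0 Ω (fun x => U 0 x - V 0 x) (fun x => U 0 x - V 0 x) from
    fun n hn => Real.sqrt_le_sqrt (h n hn)
  intro n
  induction n using Nat.strong_induction_on with
  | _ n ih =>
    intro hn
    rcases Nat.eq_zero_or_pos n with rfl | hpos
    · exact le_rfl
    have hα2 := fun l => (hα l).2
    have hUr := hU.regular n hpos hn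
    have hVr := hV.regular n hpos hn
    -- The bound `B` is `‖e^0‖²` at every level; strong induction is needed because the history
    -- involves all earlier errors.
    refine FracScheme.inner0_self_le_of_step (e := fun m x => U m x - V m x) (n := n)
      (W := fun k => ∑ r, c r * -FracScheme.omega (θ r) k)
      (Z := ∑ r, c r * ∑ k ∈ Finset.range n, FracScheme.omega (θ r) k)
      hΩo hΩc hΩb hα hεp hεm hA ?_ ?_ ?_ (hUr.sub hΩo hΩc hΩb hα2 hVr)
      (fun m hm => (hU.memLp m (hm.trans hn)).sub (hV.memLp m (hm.trans hn))) ?_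
      (hgrad n hpos hn) ?_ (fun m hm => ih m hm (hm.le.trans hn)) hpos
    · exact Finset.sum_nonneg fun r _ =>
        mul_nonneg (hc0 r) (FracScheme.sum_omega_nonneg (hθ r).2 n)
    · exact fun k hk => Finset.sum_nonneg fun r _ => mul_nonneg (hc0 r)
        (neg_nonneg.2 (FracScheme.omega_nonpos (hθ r).1.le (hθ r).2 (Finset.mem_Ico.1 hk).1))
    -- After the sums are exchanged, the weights belonging to each `r` add up to `c r`.
    · rw [Finset.sum_comm, ← Finset.sum_add_distrib]
      refine Finset.sum_congr rfl fun r _ => ?_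
      rw [← Finset.mul_sum, ← mul_add, FracScheme.sum_Ico_neg_omega_add_sum_range _ hpos, mul_one]
    · intro p hp
      simpa using (hU.boundary n hpos hn p hp).sub (hV.boundary n hpos hn p hp)
    · exact fun x hx => (hU.equation n hpos hn x hx).sub (hV.equation n hpos hn x hx)
        (fun l => FracScheme.fracLeft_sub hΩo hΩc hΩb hUr hVr (hα2 l) hx)
        (fun l => FracScheme.fracRight_sub hΩo hΩc hΩb hUr hVr (hα2 l) hx)
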